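/- Let $A$ be a small Reedy category: a small category with two wide subcategories $A^{\to}$ and $A^{\gets}$ and a functorial factorization of every morphism into a morphism of $A^{\gets}$ followed by a morphism of $A^{\to}$, such that there is an ordinal-valued degree function on the objects of $A$ that is strictly raised by every nonidentity morphism of $A^{\to}$ and strictly lowered by every nonidentity morphism of $A^{\gets}$. The opposite category $A^{\mathrm{op}}$ is again a Reedy category, with $(A^{\mathrm{op}})^{\to}=(A^{\gets})^{\mathrm{op}}$ and $(A^{\mathrm{op}})^{\gets}=(A^{\to})^{\mathrm{op}}$. Let $\mathbf{M}$ be a model category with all small limits and colimits, and let $\mathbf{M}(A)$ be the category of functors $A^{\mathrm{op}}\to\mathbf{M}$ with its Reedy weak equivalences, cofibrations and fibrations. That is, a morphism $\varphi\colon X\to Y$ of $\mathbf{M}(A)$ is - a weak equivalence if $\varphi_\alpha\colon X_\alpha\to Y_\alpha$ is a weak equivalence of $\mathbf{M}$ for every object $\alpha$; - a cofibration if for every object $\alpha$ the relative latching morphism $X_\alpha\amalg^{L_\alpha X}L_\alpha Y\to Y_\alpha$ is a cofibration of $\mathbf{M}$, where $L_\alpha X=\operatorname{colim}_{\beta\to\alpha}X_\beta$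 over the category of nonidentity morphisms $\beta\to\alpha$ of $(A^{\mathrm{op}})^{\to}$; - a fibration if for every object $\alpha$ the relative matching morphism $X_\alpha\to M^\alpha X\times_{M^\alpha Y}Y_\alpha$ is a fibration of $\mathbf{M}$, where $M^\alpha X=\lim_{\alpha\to\beta}X_\beta$ over the category of nonidentity morphisms $\alpha\to\beta$ of $(A^{\mathrm{op}})^{\gets}$. If $\mathbf{M}$ is left proper (the pushout of a weak equivalence along a cofibration is a weak equivalence), then $\mathbf{M}(A)$ with its Reedy classes is left proper. If $\mathbf{M}$ is right proper (the pullback of a weak equivalence along a fibration is a weak equivalence), then $\mathbf{M}(A)$ with its Reedy classes is right proper. -/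

import Mathlib

open CategoryTheory Limits HomotopicalAlgebra

universe w v u

section Proper

variable (C : Type u) [Category.{v} C] [CategoryWithWeakEquivalences C]

/-- Left properness: the pushout of a weak equivalence along a cofibration is a weak
equivalence. -/
def IsLeftProper [CategoryWithCofibrations C] : Prop :=
  ∀ ⦃A B X Y : C⦄ (i : A ⟶ B) (f : A ⟶ X) (f' : B ⟶ Y) (i' : X ⟶ Y),
    IsPushout i f f' i' → Cofibration i → WeakEquivalence f → WeakEquivalence f'

/-- Right properness: the pullback of a weak equivalence along a fibration is a weak
equivalence. -/
def IsRightProper [CategoryWithFibrations C] : Prop :=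
  ∀ ⦃A B X Y : C⦄ (f' : A ⟶ B) (p' : A ⟶ X) (p : B ⟶ Y) (f : X ⟶ Y),
    IsPullback f' p' p f → Fibration p → WeakEquivalence f → WeakEquivalence f'

end Proper

/-- The data of a Reedy category with underlying small category `A`: two wide subcategories
(the direct one `A^→` and the inverse one `A^←`), a functorial factorization of every morphism
into a morphism of `A^←` followed by a morphism of `A^→`, such that there exists an ordinal valued
degree function on objects which is a linear extension of `A^→` and of the opposite of `A^←`,
i.e. which is strictly raised by the nonidentity morphisms of `A^→` and strictly lowered by the
nonidentity morphisms of `A^←`. -/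
structure ReedyCategory (A : Type w) [SmallCategory A] where
  /-- the morphisms of `A^→` -/
  direct : MorphismProperty A
  /-- the morphisms of `A^←` -/
  inverse : MorphismProperty A
  direct_isMultiplicative : direct.IsMultiplicative
  inverse_isMultiplicative : inverse.IsMultiplicative
  /-- the functorial factorization -/
  factorization : MorphismProperty.FunctorialFactorizationData inverse direct
  exists_degree : ∃ deg : A → Ordinal.{w},
    (∀ ⦃a b : A⦄ (f : a ⟶ b), direct f → ¬ MorphismProperty.identities A f → deg a < deg b) ∧
    (∀ ⦃a b : A⦄ (f : a ⟶ b), inverse f → ¬ MorphismProperty.identities A f → deg b < deg a)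

namespace ReedyCategory

attribute [instance] direct_isMultiplicative inverse_isMultiplicative

/-- The opposite Reedy category: `(Aᵒᵖ)^→ = (A^←)ᵒᵖ` and `(Aᵒᵖ)^← = (A^→)ᵒᵖ`. -/
def op {A : Type w} [SmallCategory A] (R : ReedyCategory A) : ReedyCategory Aᵒᵖ where
  direct := R.inverse.op
  inverse := R.direct.op
  direct_isMultiplicative := inferInstance
  inverse_isMultiplicative := inferInstance
  factorization :=
    { Z :=
        { obj f := Opposite.op (R.factorization.Z.obj (Arrow.mk f.hom.unop))
          map {f g} φ := (R.factorization.Z.map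
            (Arrow.homMk φ.right.unop φ.left.unop (Quiver.Hom.op_inj φ.w.symm) :
              Arrow.mk g.hom.unop ⟶ Arrow.mk f.hom.unop)).op
          map_id f := Quiver.Hom.unop_inj (R.factorization.Z.map_id (Arrow.mk f.hom.unop))
          map_comp {f g h} φ ψ := Quiver.Hom.unop_inj (R.factorization.Z.map_comp
            (Arrow.homMk ψ.right.unop ψ.left.unop (Quiver.Hom.op_inj ψ.w.symm) :
              Arrow.mk h.hom.unop ⟶ Arrow.mk g.hom.unop)
            (Arrow.homMk φ.right.unop φ.left.unop (Quiver.Hom.op_inj φ.w.symm) :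
              Arrow.mk g.hom.unop ⟶ Arrow.mk f.hom.unop)) }
      i :=
        { app f := (R.factorization.p.app (Arrow.mk f.hom.unop)).op
          naturality f g φ := Quiver.Hom.unop_inj (R.factorization.p.naturality
            (Arrow.homMk φ.right.unop φ.left.unop (Quiver.Hom.op_inj φ.w.symm) :
              Arrow.mk g.hom.unop ⟶ Arrow.mk f.hom.unop)).symm }
      p :=
        { app f := (R.factorization.i.app (Arrow.mk f.hom.unop)).op
          naturality f g φ := Quiver.Hom.unop_inj (R.factorization.i.naturality
            (Arrow.homMk φ.right.unop φ.left.unop (Quiver.Hom.op_inj φ.w.symm) :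
              Arrow.mk g.hom.unop ⟶ Arrow.mk f.hom.unop)).symm }
      fac := by
        ext f
        exact Quiver.Hom.unop_inj
          (R.factorization.fac_app (f := Arrow.mk f.hom.unop))
      hi f := R.factorization.hp (Arrow.mk f.hom.unop)
      hp f := R.factorization.hi (Arrow.mk f.hom.unop) }
  exists_degree := by
    obtain ⟨deg, h₁, h₂⟩ := R.exists_degree
    refine ⟨fun a ↦ deg a.unop, fun a b f hf hf' ↦ h₂ f.unop hf ?_,
      fun a b f hf hf' ↦ h₁ f.unop hf ?_⟩
    · simpa [MorphismProperty.identities_op_iff] using hf'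
    · simpa [MorphismProperty.identities_op_iff] using hf'

end ReedyCategory

noncomputable section

section LatchingMatching

variable {D : Type w} [SmallCategory D] {C : Type u} [Category.{v} C]

/-- The latching category at `a`: the full subcategory of the slice `D/a` consisting of the
nonidentity morphisms `b ⟶ a`. -/
abbrev LatchingCategory (a : D) : Type w :=
  ObjectProperty.FullSubcategory
    (fun f : Over a ↦ ¬ MorphismProperty.identities D (X := f.left) (Y := a) f.hom)

/-- The matching category at `a`: the full subcategory of the coslice `a/D` consisting of the
nonidentity morphisms `a ⟶ b`. -/
abbrev MatchingCategory (a : D) : Type w :=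
  ObjectProperty.FullSubcategory
    (fun f : Under a ↦ ¬ MorphismProperty.identities D (X := a) (Y := f.right) f.hom)

/-- The forgetful functor from the latching category. -/
abbrev latchingForget (a : D) : LatchingCategory a ⥤ D :=
  ObjectProperty.ι _ ⋙ Over.forget a

/-- The forgetful functor from the matching category. -/
abbrev matchingForget (a : D) : MatchingCategory a ⥤ D :=
  ObjectProperty.ι _ ⋙ Under.forget a

section Latching

variable [HasColimitsOfSize.{w, w} C]

/-- The latching object `L_a X`. -/
def latchingObj (X : D ⥤ C) (a : D) : C :=
  colimit (latchingForget a ⋙ X)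

/-- The canonical morphism `L_a X ⟶ X_a`, given on the summand of `f : b ⟶ a` by `X(f)`. -/
def latchingMap (X : D ⥤ C) (a : D) : latchingObj X a ⟶ X.obj a :=
  colimit.desc (latchingForget a ⋙ X)
    { pt := X.obj a
      ι :=
        { app f := X.map f.obj.hom
          naturality f g φ := by
            have h := Over.w φ.hom
            simp only [Functor.const_obj_obj, Functor.const_obj_map, Category.comp_id]
            rw [← h]
            exact (X.map_comp _ _).symm } }

lemma ι_latchingMap (X : D ⥤ C) (a : D) (f : LatchingCategory a) :
    colimit.ι (latchingForget a ⋙ X) f ≫ latchingMap X a = X.map f.obj.hom :=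
  colimit.ι_desc _ f

/-- The morphism `L_a X ⟶ L_a Y` induced by `φ : X ⟶ Y`. -/
def latchingObjMap {X Y : D ⥤ C} (φ : X ⟶ Y) (a : D) : latchingObj X a ⟶ latchingObj Y a :=
  colimMap (Functor.whiskerLeft (latchingForget a) φ)

lemma latchingMap_naturality {X Y : D ⥤ C} (φ : X ⟶ Y) (a : D) :
    latchingMap X a ≫ φ.app a = latchingObjMap φ a ≫ latchingMap Y a := by
  refine colimit.hom_ext fun f ↦ ?_
  refine (Category.assoc _ _ _).symm.trans (Eq.trans ?_ (Category.assoc _ _ _))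
  refine ((congrArg (· ≫ φ.app a) (ι_latchingMap X a f)).trans ?_).trans
    (congrArg (· ≫ latchingMap Y a)
      (ι_colimMap (Functor.whiskerLeft (latchingForget a) φ) f).symm)
  refine Eq.trans ?_ (Category.assoc _ _ _).symm
  exact (φ.naturality f.obj.hom).trans
    (congrArg (φ.app f.obj.left ≫ ·) (ι_latchingMap Y a f).symm)

/-- The relative latching morphism `X_a ⨿_{L_a X} L_a Y ⟶ Y_a`. -/
def relativeLatchingMap [HasPushouts C] {X Y : D ⥤ C} (φ : X ⟶ Y) (a : D) :
    pushout (latchingMap X a) (latchingObjMap φ a) ⟶ Y.obj a :=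
  pushout.desc (φ.app a) (latchingMap Y a) (latchingMap_naturality φ a)

end Latching

section Matching

variable [HasLimitsOfSize.{w, w} C]

/-- The matching object `M^a X`. -/
def matchingObj (X : D ⥤ C) (a : D) : C :=
  limit (matchingForget a ⋙ X)

/-- The canonical morphism `X_a ⟶ M^a X`, given on the factor of `f : a ⟶ b` by `X(f)`. -/
def matchingMap (X : D ⥤ C) (a : D) : X.obj a ⟶ matchingObj X a :=
  limit.lift (matchingForget a ⋙ X)
    { pt := X.obj a
      π :=
        { app f := X.map f.obj.hom
          naturality f g φ := by
            have h := Under.w φ.hom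
            simp only [Functor.const_obj_obj, Functor.const_obj_map, Category.id_comp]
            rw [← h]
            exact X.map_comp _ _ } }

lemma matchingMap_π (X : D ⥤ C) (a : D) (f : MatchingCategory a) :
    matchingMap X a ≫ limit.π (matchingForget a ⋙ X) f = X.map f.obj.hom :=
  limit.lift_π _ f

/-- The morphism `M^a X ⟶ M^a Y` induced by `φ : X ⟶ Y`. -/
def matchingObjMap {X Y : D ⥤ C} (φ : X ⟶ Y) (a : D) : matchingObj X a ⟶ matchingObj Y a :=
  limMap (Functor.whiskerLeft (matchingForget a) φ)

lemma matchingMap_naturality {X Y : D ⥤ C} (φ : X ⟶ Y) (a : D) :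
    matchingMap X a ≫ matchingObjMap φ a = φ.app a ≫ matchingMap Y a := by
  refine limit.hom_ext fun f ↦ ?_
  refine (Category.assoc _ _ _).trans (Eq.trans ?_ (Category.assoc _ _ _).symm)
  refine ((congrArg (matchingMap X a ≫ ·)
      (limMap_π (Functor.whiskerLeft (matchingForget a) φ) f)).trans ?_).trans
    (congrArg (φ.app a ≫ ·) (matchingMap_π Y a f).symm)
  refine (Category.assoc _ _ _).symm.trans ?_
  exact (congrArg (· ≫ φ.app f.obj.right) (matchingMap_π X a f)).trans
    (φ.naturality f.obj.hom)

/-- The relative matching morphism `X_a ⟶ M^a X ×_{M^a Y} Y_a`. -/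
def relativeMatchingMap [HasPullbacks C] {X Y : D ⥤ C} (φ : X ⟶ Y) (a : D) :
    X.obj a ⟶ pullback (matchingObjMap φ a) (matchingMap Y a) :=
  pullback.lift (matchingMap X a) (φ.app a) (matchingMap_naturality φ a)

end Matching

end LatchingMatching

section ReedyModelCategory

variable {A : Type w} [SmallCategory A]

/-- The category of functors `A ⥤ M`, as a type synonym on which the Reedy weak equivalences,
cofibrations and fibrations are defined. -/
def ReedyDiagram (_ : ReedyCategory A) (M : Type u) [Category.{v} M] := A ⥤ M

instance (R : ReedyCategory A) (M : Type u) [Category.{v} M] : Category (ReedyDiagram R M) :=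
  inferInstanceAs (Category (A ⥤ M))

namespace ReedyDiagram

variable {R : ReedyCategory A} {M : Type u} [Category.{v} M]

/-- The restriction of a diagram to the direct subcategory `A^→`. -/
def restrictDirect : ReedyDiagram R M ⥤ (WideSubcategory R.direct ⥤ M) :=
  (Functor.whiskeringLeft _ _ M).obj (wideSubcategoryInclusion R.direct)

/-- The restriction of a diagram to the inverse subcategory `A^←`. -/
def restrictInverse : ReedyDiagram R M ⥤ (WideSubcategory R.inverse ⥤ M) :=
  (Functor.whiskeringLeft _ _ M).obj (wideSubcategoryInclusion R.inverse)

/-- Reedy weak equivalences are the objectwise weak equivalences. -/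
instance [CategoryWithWeakEquivalences M] : CategoryWithWeakEquivalences (ReedyDiagram R M) where
  weakEquivalences X Y φ := ∀ a : A, WeakEquivalence (NatTrans.app (F := X) (G := Y) φ a)

/-- A morphism is a Reedy cofibration if all relative latching morphisms of its restriction to
`A^→` are cofibrations. -/
instance [CategoryWithCofibrations M] [HasColimitsOfSize.{w, w} M] [HasPushouts M] :
    CategoryWithCofibrations (ReedyDiagram R M) where
  cofibrations _ _ φ := ∀ a : WideSubcategory R.direct,
    Cofibration (relativeLatchingMap (restrictDirect.map φ) a)

/-- A morphism is a Reedy fibration if all relative matching morphisms of its restriction to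
`A^←` are fibrations. -/
instance [CategoryWithFibrations M] [HasLimitsOfSize.{w, w} M] [HasPullbacks M] :
    CategoryWithFibrations (ReedyDiagram R M) where
  fibrations _ _ φ := ∀ a : WideSubcategory R.inverse,
    Fibration (relativeMatchingMap (restrictInverse.map φ) a)

end ReedyDiagram

/-- `M(A)`: the category of functors `Aᵒᵖ ⥤ M` with its Reedy weak equivalences, cofibrations and
fibrations, for the opposite Reedy category `Aᵒᵖ`. -/
abbrev ReedyPresheaf (R : ReedyCategory A) (M : Type u) [Category.{v} M] :=
  ReedyDiagram R.op M

end ReedyModelCategory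

end

/-! Weak equivalences are objectwise, and so are pushouts and pullbacks of diagrams. Properness
therefore passes from `M` to diagrams once Reedy cofibrations (fibrations) are known to be
objectwise cofibrations (fibrations).

For cofibrations, `φ.app a` has to lift against a trivial fibration `p : E ⟶ B`. Lifts `Y.obj b ⟶ E`
are built for all nonidentity `b ⟶ a` in the direct subcategory, by recursion on degree. Lifts
already chosen below `b` amount to a map `L_b Y ⟶ E`, and lifting the relative latching morphism
extends it to `Y.obj b`. `LiftExtensionProperty` states this step without colimits, so that the same
recursion (`hasLiftingProperty_app_of_liftExtensionProperty`), run in the opposite categories, also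
handles fibrations. -/

open MorphismProperty

/-! ### Compatible lifts by recursion on the degree -/

section LiftExtension

variable {D : Type*} [Category* D] {C : Type*} [Category* C]

lemma comp_comp_eq {W X Y Z : C} {f : W ⟶ X} {g : X ⟶ Y} {k : W ⟶ Y} (h : f ≫ g = k)
    (e : Y ⟶ Z) : f ≫ g ≫ e = k ≫ e := by
  rw [← Category.assoc, h]

/-- The morphism `φ : X ⟶ Y` of diagrams has the extension property at `a` with respect to `p` if
every lifting problem from `φ.app a` to `p`, together with a compatible family of solutions of the
induced lifting problems indexed by the nonidentity morphisms `b ⟶ a`, has a solution which is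
compatible with this family. -/
def LiftExtensionProperty {X Y : D ⥤ C} (φ : X ⟶ Y) {E B : C} (p : E ⟶ B) (a : D) : Prop :=
  ∀ (u : X.obj a ⟶ E) (v : Y.obj a ⟶ B) (_ : φ.app a ≫ v = u ≫ p)
    (l : ∀ ⦃b : D⦄ (f : b ⟶ a), ¬ identities D f → (Y.obj b ⟶ E))
    (_ : ∀ ⦃b : D⦄ (f : b ⟶ a) (hf : ¬ identities D f), φ.app b ≫ l f hf = X.map f ≫ u)
    (_ : ∀ ⦃b : D⦄ (f : b ⟶ a) (hf : ¬ identities D f), l f hf ≫ p = Y.map f ≫ v)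
    (_ : ∀ ⦃c b : D⦄ (g : c ⟶ b) (f : b ⟶ a) (hf : ¬ identities D f)
      (hgf : ¬ identities D (g ≫ f)), Y.map g ≫ l f hf = l (g ≫ f) hgf),
    ∃ m : Y.obj a ⟶ E, φ.app a ≫ m = u ∧ m ≫ p = v ∧
      ∀ ⦃b : D⦄ (f : b ⟶ a) (hf : ¬ identities D f), Y.map f ≫ m = l f hf

/-- The nonidentity morphisms of a category with a strictly increasing degree function are
closed under composition. -/
lemma not_identities_comp {deg : D → Ordinal.{w}}
    (hdeg : ∀ ⦃a b : D⦄ (f : a ⟶ b), ¬ identities D f → deg a < deg b)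
    ⦃a b c : D⦄ (f : a ⟶ b) (g : b ⟶ c) (hf : ¬ identities D f) (hg : ¬ identities D g) :
    ¬ identities D (f ≫ g) := by
  intro h
  have hac : deg a = deg c := by
    generalize f ≫ g = k at h
    cases h
    rfl
  exact ((hdeg f hf).trans (hdeg g hg)).ne hac

/-- Over a direct category, the extension property at all objects implies the objectwise left
lifting property. -/
theorem hasLiftingProperty_app_of_liftExtensionProperty {deg : D → Ordinal.{w}}
    (hdeg : ∀ ⦃a b : D⦄ (f : a ⟶ b), ¬ identities D f → deg a < deg b)
    {X Y : D ⥤ C} (φ : X ⟶ Y) {E B : C} (p : E ⟶ B)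
    (h : ∀ a, LiftExtensionProperty φ p a) (a : D) : HasLiftingProperty (φ.app a) p := by
  induction a using (InvImage.wf deg Ordinal.lt_wf).induction with
  | h a ih =>
  refine ⟨fun {u v} sq ↦ ?_⟩
  -- Each induced lifting problem has a solution, by the induction hypothesis.
  have hne : ∀ {b : D} (f : b ⟶ a), ¬ identities D f →
      Nonempty {l : Y.obj b ⟶ E // φ.app b ≫ l = X.map f ≫ u ∧ l ≫ p = Y.map f ≫ v} := by
    intro b f hf
    have := ih b (hdeg f hf)
    have sq' : CommSq (X.map f ≫ u) (φ.app b) p (Y.map f ≫ v) :=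
      ⟨by rw [Category.assoc, sq.w, ← Category.assoc, φ.naturality, Category.assoc]⟩
    exact ⟨sq'.lift, sq'.fac_left, sq'.fac_right⟩
  -- Choose these solutions by recursion on the degree, compatibly whenever this is possible.
  let S (b : D) : Type _ := ∀ (f : b ⟶ a), ¬ identities D f →
    {l : Y.obj b ⟶ E // φ.app b ≫ l = X.map f ≫ u ∧ l ≫ p = Y.map f ≫ v}
  let Good (b : D) (rec : ∀ c, deg c < deg b → S c) (f : b ⟶ a) (hf : ¬ identities D f)
      (l : {l : Y.obj b ⟶ E // φ.app b ≫ l = X.map f ≫ u ∧ l ≫ p = Y.map f ≫ v}) : Prop :=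
    ∀ ⦃c : D⦄ (g : c ⟶ b) (hg : ¬ identities D g),
      Y.map g ≫ l.1 = (rec c (hdeg g hg) (g ≫ f) (not_identities_comp hdeg g f hg hf)).1
  -- That a compatible solution exists depends on the compatibility of earlier choices, which `rec`
  -- does not record. Hence `epsilon`, with an arbitrary solution from `hne` as fallback; `good`
  -- shows later that the choice is always compatible.
  let step (b : D) (rec : ∀ c, deg c < deg b → S c) : S b := fun f hf ↦
    Classical.epsilon (h := hne f hf) (Good b rec f hf)
  let L : ∀ b, S b := (InvImage.wf deg Ordinal.lt_wf).fix step
  have hL (b : D) : L b = step b (fun c _ ↦ L c) := WellFounded.fix_eq _ _ _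
  have L_congr {b : D} {f g : b ⟶ a} (hfg : f = g) (hf : ¬ identities D f)
      (hg : ¬ identities D g) : (L b f hf).1 = (L b g hg).1 := by
    subst hfg
    rfl
  have good (b : D) : ∀ (f : b ⟶ a) (hf : ¬ identities D f),
      Good b (fun c _ ↦ L c) f hf (L b f hf) := by
    induction b using (InvImage.wf deg Ordinal.lt_wf).induction with
    | h b ihb =>
    intro f hf
    -- The family below `b` consists of the lifts chosen along the composites `g ≫ f`; it is
    -- compatible by `ihb`.
    obtain ⟨m, hm₁, hm₂, hm₃⟩ := h b (X.map f ≫ u) (Y.map f ≫ v)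
      (by rw [Category.assoc, sq.w, ← Category.assoc, ← φ.naturality, Category.assoc])
      (fun c g hg ↦ (L c (g ≫ f) (not_identities_comp hdeg g f hg hf)).1)
      (fun c g hg ↦ by
        rw [(L c (g ≫ f) (not_identities_comp hdeg g f hg hf)).2.1, X.map_comp, Category.assoc])
      (fun c g hg ↦ by
        rw [(L c (g ≫ f) (not_identities_comp hdeg g f hg hf)).2.2, Y.map_comp, Category.assoc])
      (fun d c k g hg hkg ↦ by
        by_cases hk : identities D k
        · cases hk
          rw [Y.map_id, Category.id_comp]
          exact L_congr (by rw [Category.id_comp]) _ _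
        · rw [ihb c (hdeg g hg) (g ≫ f) (not_identities_comp hdeg g f hg hf) k hk]
          exact L_congr (Category.assoc _ _ _).symm _ _)
    rw [hL b]
    exact Classical.epsilon_spec_aux (hne f hf) (Good b (fun c _ ↦ L c) f hf)
      ⟨⟨m, hm₁, hm₂⟩, fun c g hg ↦ hm₃ g hg⟩
  -- Only the identity of `a` is still without a lift; one more extension provides it.
  obtain ⟨m, hm₁, hm₂, -⟩ := h a u v sq.w.symm (fun b f hf ↦ (L b f hf).1)
    (fun b f hf ↦ (L b f hf).2.1) (fun b f hf ↦ (L b f hf).2.2)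
    (fun c b g f hf hgf ↦ by
      by_cases hg : identities D g
      · cases hg
        rw [Y.map_id, Category.id_comp]
        exact L_congr (Category.id_comp f).symm _ _
      · exact good b f hf g hg)
  exact ⟨⟨⟨m, hm₁, hm₂⟩⟩⟩

end LiftExtension

/-! ### Extension from relative latching and matching morphisms -/

section LatchingMatching

variable {D : Type w} [SmallCategory D] {C : Type u} [Category.{v} C]

/-- If a relative latching morphism has the left lifting property with respect to `p`, then the
extension property with respect to `p` holds. -/
lemma liftExtensionProperty_of_relativeLatchingMap [HasColimitsOfSize.{w, w} C] [HasPushouts C]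
    {X Y : D ⥤ C} (φ : X ⟶ Y) {E B : C} (p : E ⟶ B) (a : D)
    [HasLiftingProperty (relativeLatchingMap φ a) p] : LiftExtensionProperty φ p a := by
  intro u v sq l hl₁ hl₂ hl₃
  -- The compatibility `hl₃` is exactly the cocone condition on the family `l`.
  let t : latchingObj Y a ⟶ E := colimit.desc (latchingForget a ⋙ Y)
    { pt := E
      ι :=
        { app f := l f.obj.hom f.property
          naturality f g k := by
            have hk : k.hom.left ≫ g.obj.hom = f.obj.hom := Over.w k.hom
            have hgf : ¬ identities D (k.hom.left ≫ g.obj.hom) := hk ▸ f.property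
            have h₁ := hl₃ k.hom.left g.obj.hom g.property hgf
            have h₂ : l (k.hom.left ≫ g.obj.hom) hgf = l f.obj.hom f.property := by
              congr 1
            exact (h₁.trans h₂).trans (Category.comp_id _).symm } }
  have ht (f : LatchingCategory a) :
      colimit.ι (latchingForget a ⋙ Y) f ≫ t = l f.obj.hom f.property := colimit.ι_desc _ f
  have hmap (f : LatchingCategory a) :
      colimit.ι (latchingForget a ⋙ X) f ≫ latchingObjMap φ a =
        φ.app f.obj.left ≫ colimit.ι (latchingForget a ⋙ Y) f :=
    ι_colimMap (Functor.whiskerLeft (latchingForget a) φ) f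
  have w₁ : latchingMap X a ≫ u = latchingObjMap φ a ≫ t :=
    colimit.hom_ext fun f ↦
      (comp_comp_eq (ι_latchingMap X a f) u).trans <| (hl₁ _ f.property).symm.trans <|
        (congrArg (φ.app f.obj.left ≫ ·) (ht f)).symm.trans <|
          (Category.assoc _ _ _).symm.trans (comp_comp_eq (hmap f) t).symm
  have w₂ : t ≫ p = latchingMap Y a ≫ v :=
    colimit.hom_ext fun f ↦ (comp_comp_eq (ht f) p).trans <|
      (hl₂ _ f.property).trans (comp_comp_eq (ι_latchingMap Y a f) v).symm
  have inl_rel : pushout.inl (latchingMap X a) (latchingObjMap φ a) ≫ relativeLatchingMap φ a =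
      φ.app a := pushout.inl_desc _ _ _
  have inr_rel : pushout.inr (latchingMap X a) (latchingObjMap φ a) ≫ relativeLatchingMap φ a =
      latchingMap Y a := pushout.inr_desc _ _ _
  -- A lift in this square restricts to `u` on `X.obj a` and to `t` on `L_a Y`, hence to every `l
  -- f`.
  have sq' : CommSq (pushout.desc u t w₁) (relativeLatchingMap φ a) p v :=
    ⟨pushout.hom_ext
      ((comp_comp_eq (pushout.inl_desc _ _ _) p).trans <|
        sq.symm.trans (comp_comp_eq inl_rel v).symm)
      ((comp_comp_eq (pushout.inr_desc _ _ _) p).trans <|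
        w₂.trans (comp_comp_eq inr_rel v).symm)⟩
  have h₁ : latchingMap Y a ≫ sq'.lift = t :=
    (comp_comp_eq inr_rel sq'.lift).symm.trans <|
      (congrArg (pushout.inr _ _ ≫ ·) sq'.fac_left).trans (pushout.inr_desc _ _ _)
  exact ⟨sq'.lift, (comp_comp_eq inl_rel sq'.lift).symm.trans <|
      (congrArg (pushout.inl _ _ ≫ ·) sq'.fac_left).trans (pushout.inl_desc _ _ _),
    sq'.fac_right, fun b f hf ↦
      (comp_comp_eq (ι_latchingMap Y a ⟨Over.mk f, hf⟩) sq'.lift).symm.trans <|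
        (congrArg (colimit.ι (latchingForget a ⋙ Y) ⟨Over.mk f, hf⟩ ≫ ·) h₁).trans (ht _)⟩

/-- If a relative matching morphism has the right lifting property with respect to `i`, then the
extension property holds for the opposite diagrams with respect to `i.op`. -/
lemma liftExtensionProperty_op_of_relativeMatchingMap [HasLimitsOfSize.{w, w} C] [HasPullbacks C]
    {X Y : D ⥤ C} (φ : X ⟶ Y) {K L : C} (i : K ⟶ L) (a : D)
    [HasLiftingProperty i (relativeMatchingMap φ a)] :
    LiftExtensionProperty (NatTrans.op φ) i.op (Opposite.op a) := by
  -- Passing to opposites swaps the two sides of the square: `u.unop : K ⟶ X.obj a` and `v.unop : L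
  -- ⟶ Y.obj a`.
  intro v u sq l hl₁ hl₂ hl₃
  have hop {b : D} (f : a ⟶ b) (hf : ¬ identities D f) : ¬ identities Dᵒᵖ f.op := by
    rwa [identities_op_iff]
  let t : L ⟶ matchingObj X a := limit.lift (matchingForget a ⋙ X)
    { pt := L
      π :=
        { app f := (l f.obj.hom.op (hop _ f.property)).unop
          naturality f g k := by
            have hk : f.obj.hom ≫ k.hom.right = g.obj.hom := Under.w k.hom
            have hfk : ¬ identities D (f.obj.hom ≫ k.hom.right) := hk ▸ g.property
            have h₁ := hl₃ k.hom.right.op f.obj.hom.op (hop _ f.property) (hop _ hfk)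
            have h₂ : l (f.obj.hom ≫ k.hom.right).op (hop _ hfk) =
                l g.obj.hom.op (hop _ g.property) := by
              congr 1
              exact congrArg Quiver.Hom.op hk
            exact (Category.id_comp _).trans (congrArg Quiver.Hom.unop (h₁.trans h₂)).symm } }
  have ht (f : MatchingCategory a) :
      t ≫ limit.π (matchingForget a ⋙ X) f = (l f.obj.hom.op (hop _ f.property)).unop :=
    limit.lift_π _ f
  have hmap (f : MatchingCategory a) :
      matchingObjMap φ a ≫ limit.π (matchingForget a ⋙ Y) f =
        limit.π (matchingForget a ⋙ X) f ≫ φ.app f.obj.right :=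
    limMap_π (Functor.whiskerLeft (matchingForget a) φ) f
  have w₁ : t ≫ matchingObjMap φ a = v.unop ≫ matchingMap Y a :=
    limit.hom_ext fun f ↦
      (Category.assoc _ _ _).trans <| (congrArg (t ≫ ·) (hmap f)).trans <|
        (comp_comp_eq (ht f) (φ.app f.obj.right)).trans <|
          (congrArg Quiver.Hom.unop (hl₁ _ (hop _ f.property))).trans <|
            (congrArg (v.unop ≫ ·) (matchingMap_π Y a f)).symm.trans (Category.assoc _ _ _).symm
  have w₂ : u.unop ≫ matchingMap X a = i ≫ t :=
    limit.hom_ext fun f ↦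
      (Category.assoc _ _ _).trans <| (congrArg (u.unop ≫ ·) (matchingMap_π X a f)).trans <|
        (congrArg Quiver.Hom.unop (hl₂ _ (hop _ f.property))).symm.trans <|
          (congrArg (i ≫ ·) (ht f)).symm.trans (Category.assoc _ _ _).symm
  have rel_fst : relativeMatchingMap φ a ≫ pullback.fst (matchingObjMap φ a) (matchingMap Y a) =
      matchingMap X a := pullback.lift_fst _ _ _
  have rel_snd : relativeMatchingMap φ a ≫ pullback.snd (matchingObjMap φ a) (matchingMap Y a) =
      φ.app a := pullback.lift_snd _ _ _
  have sq' : CommSq u.unop i (relativeMatchingMap φ a) (pullback.lift t v.unop w₁) :=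
    ⟨pullback.hom_ext
      ((Category.assoc _ _ _).trans <| (congrArg (u.unop ≫ ·) rel_fst).trans <| w₂.trans <|
        (congrArg (i ≫ ·) (pullback.lift_fst _ _ _)).symm.trans (Category.assoc _ _ _).symm)
      ((Category.assoc _ _ _).trans <| (congrArg (u.unop ≫ ·) rel_snd).trans <|
        (congrArg Quiver.Hom.unop sq).trans <|
        (congrArg (i ≫ ·) (pullback.lift_snd _ _ _)).symm.trans (Category.assoc _ _ _).symm)⟩
  have h₁ : sq'.lift ≫ matchingMap X a = t :=
    (congrArg (sq'.lift ≫ ·) rel_fst).symm.trans <|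
      (comp_comp_eq sq'.fac_right _).trans (pullback.lift_fst _ _ _)
  have h₂ : sq'.lift ≫ φ.app a = v.unop :=
    (congrArg (sq'.lift ≫ ·) rel_snd).symm.trans <|
      (comp_comp_eq sq'.fac_right _).trans (pullback.lift_snd _ _ _)
  refine ⟨sq'.lift.op, Quiver.Hom.unop_inj h₂, Quiver.Hom.unop_inj sq'.fac_left, fun b f hf ↦ ?_⟩
  have hf' : ¬ identities D f.unop := by rwa [← identities_op_iff]
  let f' : MatchingCategory a := ⟨Under.mk f.unop, hf'⟩
  exact Quiver.Hom.unop_inj <| (congrArg (sq'.lift ≫ ·) (matchingMap_π X a f')).symm.trans <|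
    (comp_comp_eq h₁ (limit.π (matchingForget a ⋙ X) f')).trans (ht f')

variable [ModelCategory C] {deg : D → Ordinal.{w}} {X Y : D ⥤ C} (φ : X ⟶ Y)

/-- Over a direct category, Reedy cofibrations are objectwise cofibrations. -/
theorem cofibration_app_of_relativeLatchingMap [HasColimitsOfSize.{w, w} C]
    (hdeg : ∀ ⦃a b : D⦄ (f : a ⟶ b), ¬ identities D f → deg a < deg b)
    (hφ : ∀ a, Cofibration (relativeLatchingMap φ a)) (a : D) : Cofibration (φ.app a) := by
  -- Being a cofibration becomes a lifting problem against one trivial fibration at a time.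
  rw [cofibration_iff, ← trivialFibrations_llp]
  intro E B p hp
  obtain ⟨_, _⟩ := (mem_trivialFibrations_iff p).1 hp
  exact hasLiftingProperty_app_of_liftExtensionProperty hdeg φ p
    (fun b ↦ liftExtensionProperty_of_relativeLatchingMap φ p b) a

/-- Over an inverse category, Reedy fibrations are objectwise fibrations. -/
theorem fibration_app_of_relativeMatchingMap [HasLimitsOfSize.{w, w} C]
    (hdeg : ∀ ⦃a b : D⦄ (f : a ⟶ b), ¬ identities D f → deg b < deg a)
    (hφ : ∀ a, Fibration (relativeMatchingMap φ a)) (a : D) : Fibration (φ.app a) := by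
  rw [fibration_iff, ← trivialCofibrations_rlp]
  intro K L i hi
  obtain ⟨_, _⟩ := (mem_trivialCofibrations_iff i).1 hi
  -- The opposite of an inverse category is direct for the same degree function.
  have := hasLiftingProperty_app_of_liftExtensionProperty (deg := fun b : Dᵒᵖ ↦ deg b.unop)
    (fun b c f hf ↦ hdeg f.unop (by rwa [← identities_op_iff])) (NatTrans.op φ) i.op
    (fun b ↦ liftExtensionProperty_op_of_relativeMatchingMap φ i b.unop) (Opposite.op a)
  exact this.unop

end LatchingMatching

/-! ### Properness of Reedy diagrams -/

section ReedyModelCategory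

/-- Lets the degree function of `A` serve on the direct and inverse subcategories, whose own
identities index their latching and matching categories. -/
lemma not_identities_hom {A : Type*} [Category* A] {P : MorphismProperty A} [P.IsMultiplicative]
    {a b : WideSubcategory P} (f : a ⟶ b) (hf : ¬ identities _ f) : ¬ identities A f.hom := by
  obtain ⟨a⟩ := a
  obtain ⟨b⟩ := b
  obtain ⟨f, hf'⟩ := f
  intro h
  cases h
  exact hf ⟨_⟩

namespace ReedyDiagram

variable {A : Type w} [SmallCategory A] {R : ReedyCategory A} {M : Type u} [Category.{v} M]
  [ModelCategory M] {X Y : ReedyDiagram R M} (φ : X ⟶ Y)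

/-- Reedy cofibrations are objectwise cofibrations. -/
theorem cofibration_app [HasColimitsOfSize.{w, w} M] (hφ : Cofibration φ) (a : A) :
    Cofibration (NatTrans.app (F := X) (G := Y) φ a) := by
  obtain ⟨deg, hdeg, -⟩ := R.exists_degree
  -- Restriction to a wide subcategory keeps all objects and all components of `φ`.
  exact cofibration_app_of_relativeLatchingMap (restrictDirect.map φ)
    (deg := fun b ↦ deg b.obj) (fun b c f hf ↦ hdeg f.hom f.property (not_identities_hom f hf))
    hφ.mem ⟨a⟩

/-- Reedy fibrations are objectwise fibrations. -/
theorem fibration_app [HasLimitsOfSize.{w, w} M] (hφ : Fibration φ) (a : A) :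
    Fibration (NatTrans.app (F := X) (G := Y) φ a) := by
  obtain ⟨deg, -, hdeg⟩ := R.exists_degree
  exact fibration_app_of_relativeMatchingMap (restrictInverse.map φ)
    (deg := fun b ↦ deg b.obj) (fun b c f hf ↦ hdeg f.hom f.property (not_identities_hom f hf))
    hφ.mem ⟨a⟩

variable (R M)

theorem isLeftProper [HasColimitsOfSize.{w, w} M] (hM : IsLeftProper M) :
    IsLeftProper (ReedyDiagram R M) := by
  intro K L X Y i f f' i' sq hi hf
  refine ⟨fun a ↦ ?_⟩
  have sq' : IsPushout (C := A ⥤ M) i f f' i' := sq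
  -- Evaluation at `a` preserves pushouts, so left properness of `M` applies objectwise.
  exact hM _ _ _ _ (sq'.map ((evaluation A M).obj a)) (cofibration_app i hi a) (hf.mem a)

theorem isRightProper [HasLimitsOfSize.{w, w} M] (hM : IsRightProper M) :
    IsRightProper (ReedyDiagram R M) := by
  intro K L X Y f' p' p f sq hp hf
  refine ⟨fun a ↦ ?_⟩
  have sq' : IsPullback (C := A ⥤ M) f' p' p f := sq
  exact hM _ _ _ _ (sq'.map ((evaluation A M).obj a)) (fibration_app p hp a) (hf.mem a)

end ReedyDiagram

end ReedyModelCategory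

theorem mainTheorem10 {A : Type w} [SmallCategory A] (R : ReedyCategory A)
    (M : Type u) [Category.{v} M] [ModelCategory M]
    [HasLimitsOfSize.{w, w} M] [HasColimitsOfSize.{w, w} M] :
    (IsLeftProper M → IsLeftProper (ReedyPresheaf R M)) ∧
    (IsRightProper M → IsRightProper (ReedyPresheaf R M)) :=
  ⟨ReedyDiagram.isLeftProper R.op M, ReedyDiagram.isRightProper R.op M⟩
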